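/- Let $\mathcal S$ and $\mathcal A$ be measurable spaces (states and actions) and let $\mathcal L$ be a set of latent contexts. For each $z\in\mathcal L$ let $P(\cdot\mid s,a,z)$ be a Markov transition kernel from $\mathcal S\times\mathcal A$ to $\mathcal S$, and let the reward $r(\cdot,\cdot,z):\mathcal S\times\mathcal A\to[0,r_{\max}(z)]$ and the cost $c(\cdot,\cdot,z):\mathcal S\times\mathcal A\to[0,c_{\max}(z)]$ be measurable and bounded. Let $\gamma\in[0,1)$ be the discount factor, let $p\in[1,\infty)$, and let $\pi(\cdot,z):\mathcal S\to\mathcal A$ be a measurable deterministic policy for each $z$. Fix $z\in\mathcal L$. A *return distribution* (at $z$) is a family $Z(s,a)=Z(s,a,z)$ of probability measures on $\mathbb R$ depending measurably on $(s,a)\in\mathcal S\times\mathcal A$. The operator $\mathcal T_r^{\pi,z}$ maps a return distribution $Z$ to the return distribution for which $(\mathcal T_r^{\pi,z}Z)(s,a)$ is the law of $r(s,a,z)+\gamma X$, where $s'\sim P(\cdot\mid s,a,z)$ and, conditionally on $s'$, $X\sim Z(s',\pi(s',z))$; the operator $\mathcal T_c^{\pi,z}$ is defined in the same way with $c$ in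 place of $r$. Let $$W_p(\mu,\nu)=\inf_{\rho}\Big(\int|x-y|^p\,d\rho(x,y)\Big)^{1/p}\in[0,\infty],$$ where the infimum is over all couplings $\rho$ of $\mu$ and $\nu$, and let $\bar d_p(Z_1,Z_2)=\sup_{s,a}W_p(Z_1(s,a),Z_2(s,a))\in[0,\infty]$ (with $0\cdot\infty=0$). Let $\mathcal Z_p$ be the set of return distributions $Z$ with $\sup_{s,a}\int|x|^p\,Z(s,a)(dx)<\infty$. **Theorem.** The distance $\bar d_p$ is finite on $\mathcal Z_p\times\mathcal Z_p$. For each of the two operators $\mathcal T\in\{\mathcal T_r^{\pi,z},\mathcal T_c^{\pi,z}\}$: 1. $\mathcal T$ maps $\mathcal Z_p$ into itself, and for all return distributions $Z_1,Z_2$, $$\bar d_p(\mathcal TZ_1,\mathcal TZ_2)\le\gamma\,\bar d_p(Z_1,Z_2).$$ 2. $\mathcal T$ has exactly one fixed point $Z^{\pi,z}=\mathcal TZ^{\pi,z}$ in $\mathcal Z_p$. 3. For every return distribution $Z_0$ and every integer $k\ge0$, the iterates $Z_{k+1}=\mathcal TZ_k$ satisfy $$\bar d_p(Z_k,Z^{\pi,z})\le\gamma^k\,\bar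 d_p(Z_0,Z^{\pi,z}),$$ and for $Z_0\in\mathcal Z_p$ this bound is finite, so that $\bar d_p(Z_k,Z^{\pi,z})\to0$. -/

import Mathlib

open MeasureTheory ProbabilityTheory Filter
open scoped ENNReal NNReal Topology

noncomputable section

namespace LatentRL

/-- A constrained Markov decision process conditioned on a latent context `z : L`, with state space
`S` and action space `A`: transition law `p(· | s, a, z)`, reward `r(s, a, z) ∈ [0, r_max]`,
cost `c(s, a, z) ∈ [0, c_max]` (the bounds may depend on `z`), and discount factor `γ ∈ [0, 1)`. -/
structure LatentCMDP (S A L : Type*) [MeasurableSpace S] [MeasurableSpace A] where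
  /-- the transition law `p(· | s, a, z)` -/
  trans : L → Kernel (S × A) S
  trans_markov : ∀ z, IsMarkovKernel (trans z)
  /-- the reward `r(s, a, z)` -/
  reward : S → A → L → ℝ
  reward_measurable : ∀ z, Measurable (fun x : S × A => reward x.1 x.2 z)
  rewardMax : L → ℝ
  reward_mem : ∀ s a z, reward s a z ∈ Set.Icc 0 (rewardMax z)
  /-- the cost `c(s, a, z)` -/
  cost : S → A → L → ℝ
  cost_measurable : ∀ z, Measurable (fun x : S × A => cost x.1 x.2 z)
  costMax : L → ℝ
  cost_mem : ∀ s a z, cost s a z ∈ Set.Icc 0 (costMax z)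
  /-- the discount factor -/
  γ : ℝ
  γ_nonneg : 0 ≤ γ
  γ_lt_one : γ < 1

/-- A latent-conditioned deterministic policy `π(s, z)`, measurable in the state. -/
structure Policy (S A L : Type*) [MeasurableSpace S] [MeasurableSpace A] where
  act : S → L → A
  measurable_act : ∀ z, Measurable (fun s => act s z)

/-- A return distribution at a fixed latent `z`: a measurable family `(s, a) ↦ Z(s, a, z)` of
probability measures on `ℝ`. -/
abbrev ReturnDist (S A : Type*) [MeasurableSpace S] [MeasurableSpace A] :=
  {Z : Kernel (S × A) ℝ // IsMarkovKernel Z}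

/-- The couplings of `μ` and `ν`: measures on `ℝ × ℝ` with marginals `μ` and `ν`. -/
def couplings (μ ν : Measure ℝ) : Set (Measure (ℝ × ℝ)) :=
  {ρ | ρ.map Prod.fst = μ ∧ ρ.map Prod.snd = ν}

/-- The `p`-Wasserstein distance on laws on `ℝ` (possibly `∞`):
`W_p(μ, ν) = inf_ρ (∫ |x - y| ^ p dρ(x, y)) ^ (1 / p)` over all couplings `ρ` of `μ` and `ν`. -/
def wasserstein (p : ℝ) (μ ν : Measure ℝ) : ℝ≥0∞ :=
  ⨅ ρ ∈ couplings μ ν, (∫⁻ q, ENNReal.ofReal |q.1 - q.2| ^ p ∂ρ) ^ (1 / p)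

section

variable {S A L : Type*} [MeasurableSpace S] [MeasurableSpace A]

/-- The supremal `p`-Wasserstein metric `sup_{s, a} W_p(Z₁(s, a), Z₂(s, a))`. -/
def supWasserstein (p : ℝ) (Z₁ Z₂ : ReturnDist S A) : ℝ≥0∞ :=
  ⨆ (s : S) (a : A), wasserstein p (Z₁.1 (s, a)) (Z₂.1 (s, a))

/-- The `p`-th absolute moments of `Z(s, a)` are bounded uniformly in `(s, a)`. -/
def HasBoundedMoments (p : ℝ) (Z : ReturnDist S A) : Prop :=
  ∃ C : ℝ≥0, ∀ (s : S) (a : A), ∫⁻ x, ENNReal.ofReal |x| ^ p ∂(Z.1 (s, a)) ≤ C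

/-- The Bellman kernel for an immediate signal `f`, transition law `P`, and decision rule `g`; by
`bellmanKernel_apply`, its value at `(s, a)` is the law of `f(s, a) + γ X`, where
`s' ∼ P(· | s, a)` and, given `s'`, `X ∼ Z(s', g(s'))`. -/
def bellmanKernel (P : Kernel (S × A) S) (f : S × A → ℝ) (γ : ℝ) (g : S → A)
    (Z : Kernel (S × A) ℝ) : Kernel (S × A) ℝ :=
  (Kernel.id ×ₖ (Z ∘ₖ P.map (fun s' => (s', g s')))).map
    (fun q : (S × A) × ℝ => f q.1 + γ * q.2)

theorem bellmanKernel_apply (P : Kernel (S × A) S) [IsMarkovKernel P] {f : S × A → ℝ}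
    (hf : Measurable f) (γ : ℝ) {g : S → A} (hg : Measurable g)
    (Z : Kernel (S × A) ℝ) [IsMarkovKernel Z] (x : S × A) :
    bellmanKernel P f γ g Z x =
      ((P x).bind (fun s' => Z (s', g s'))).map (fun y => f x + γ * y) := by
  have hm : Measurable (fun s' => (s', g s')) := measurable_id.prodMk hg
  have : IsMarkovKernel (P.map (fun s' => (s', g s'))) := Kernel.IsMarkovKernel.map _ hm
  have hq : Measurable (fun q : (S × A) × ℝ => f q.1 + γ * q.2) := by fun_prop
  rw [bellmanKernel, Kernel.map_apply _ hq, Kernel.prod_apply, Kernel.id_apply,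
    Measure.dirac_prod, Measure.map_map hq (by fun_prop), Kernel.comp_apply,
    Kernel.map_apply _ hm, Measure.bind, Measure.map_map Z.measurable hm]
  rfl

theorem isMarkovKernel_bellmanKernel (P : Kernel (S × A) S) [IsMarkovKernel P] {f : S × A → ℝ}
    (hf : Measurable f) (γ : ℝ) {g : S → A} (hg : Measurable g)
    (Z : Kernel (S × A) ℝ) [IsMarkovKernel Z] :
    IsMarkovKernel (bellmanKernel P f γ g Z) := by
  have hm : Measurable (fun s' => (s', g s')) := measurable_id.prodMk hg
  have : IsMarkovKernel (P.map (fun s' => (s', g s'))) := Kernel.IsMarkovKernel.map _ hm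
  have hq : Measurable (fun q : (S × A) × ℝ => f q.1 + γ * q.2) := by fun_prop
  exact Kernel.IsMarkovKernel.map _ hq

/-- The latent-conditioned distributional Bellman operator for the reward: `(T Z)(s, a)` is the law
of `r(s, a, z) + γ Z(s', π(s', z), z)` with `s' ∼ p(· | s, a, z)`. -/
def rewardBellman (M : LatentCMDP S A L) (π : Policy S A L) (z : L) (Z : ReturnDist S A) :
    ReturnDist S A :=
  ⟨bellmanKernel (M.trans z) (fun x => M.reward x.1 x.2 z) M.γ (fun s => π.act s z) Z.1,
    haveI := M.trans_markov z
    haveI := Z.2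
    isMarkovKernel_bellmanKernel _ (M.reward_measurable z) _ (π.measurable_act z) _⟩

/-- The latent-conditioned distributional Bellman operator for the cost: `(T Z)(s, a)` is the law
of `c(s, a, z) + γ Z(s', π(s', z), z)` with `s' ∼ p(· | s, a, z)`. -/
def costBellman (M : LatentCMDP S A L) (π : Policy S A L) (z : L) (Z : ReturnDist S A) :
    ReturnDist S A :=
  ⟨bellmanKernel (M.trans z) (fun x => M.cost x.1 x.2 z) M.γ (fun s => π.act s z) Z.1,
    haveI := M.trans_markov z
    haveI := Z.2
    isMarkovKernel_bellmanKernel _ (M.cost_measurable z) _ (π.measurable_act z) _⟩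

end

end LatentRL

end

namespace LatentRL

/-! On the line, an optimal coupling for `W_p` is explicit: evaluate both quantile functions at one
uniform `u` (`wasserstein_eq_quantile`). Quantiles are jointly measurable in the parameter and the
level, so optimal couplings at all next states are chosen measurably at once. Running two Bellman
backups with the same `s'` and the same `u` cancels the immediate signal and leaves a factor `γ`:
this is the contraction.

The fixed point is not obtained from completeness of the metric. Since the signal is nonnegative and
bounded by `b`, the iterates from the point mass at `0` increase stochastically and stay supported
in `[0, b / (1 - γ)]`. Their quantiles converge monotonically, the limit is again a kernel, and weak
continuity of the operator makes it a fixed point (`exists_bellman_eq`). Bounded support puts it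
among the laws with bounded moments, where distances are finite and the contraction forces
uniqueness. -/

/-! ### Quantile functions. -/

/-- The uniform law on the open unit interval. -/
noncomputable abbrev unif : Measure ℝ := volume.restrict (Set.Ioo 0 1)

instance : IsProbabilityMeasure unif := ⟨by simp⟩

/-- The quantile function of a law on `ℝ`, extended by `0` outside of `(0, 1)`. -/
noncomputable def quantile (μ : Measure ℝ) (u : ℝ) : ℝ :=
  open Classical in if u ∈ Set.Ioo (0 : ℝ) 1 then sInf {t | u ≤ μ.real (Set.Iic t)} else 0

/-- For a level strictly between 0 and 1 the limits of the cdf make the defining set nonempty and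
bounded below, and right-continuity of the cdf makes the infimum attained. -/
theorem quantile_le_iff (μ : Measure ℝ) [IsProbabilityMeasure μ] {u : ℝ}
    (hu : u ∈ Set.Ioo (0 : ℝ) 1) (t : ℝ) : quantile μ u ≤ t ↔ u ≤ μ.real (Set.Iic t) := by
  rw [quantile, if_pos hu]
  simp_rw [← cdf_eq_real]
  have hbdd : BddBelow {t | u ≤ cdf μ t} := by
    obtain ⟨b, hb⟩ := ((tendsto_cdf_atBot μ).eventually_lt_const hu.1).exists
    exact ⟨b, fun t ht => le_of_not_gt fun h => (hb.trans_le ht).not_ge (monotone_cdf μ h.le)⟩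
  have hne : {t | u ≤ cdf μ t}.Nonempty := by
    obtain ⟨b, hb⟩ := ((tendsto_cdf_atTop μ).eventually_const_lt hu.2).exists
    exact ⟨b, hb.le⟩
  refine ⟨fun h => ?_, fun h => csInf_le hbdd h⟩
  have hright : Tendsto (cdf μ) (𝓝[>] t) (𝓝 (cdf μ t)) :=
    ((cdf μ).right_continuous t).mono_left (nhdsWithin_mono _ Set.Ioi_subset_Ici_self)
  refine ge_of_tendsto hright (eventually_nhdsWithin_of_forall fun y hy => ?_)
  obtain ⟨s, hs, hsy⟩ := exists_lt_of_csInf_lt hne (h.trans_lt hy)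
  exact le_trans hs (monotone_cdf μ hsy.le)

/-- Joint measurability is what takes the place of a measurable selection of optimal couplings. -/
theorem measurable_quantile_kernel {α : Type*} [MeasurableSpace α] (κ : Kernel α ℝ)
    [IsMarkovKernel κ] : Measurable (fun q : α × ℝ => quantile (κ q.1) q.2) := by
  refine measurable_of_Iic fun t => ?_
  have hset : (fun q : α × ℝ => quantile (κ q.1) q.2) ⁻¹' Set.Iic t =
      ({q | q.2 ∈ Set.Ioo (0 : ℝ) 1} ∩ {q | q.2 ≤ (κ q.1).real (Set.Iic t)}) ∪
        ({q | q.2 ∈ Set.Ioo (0 : ℝ) 1}ᶜ ∩ {_q | 0 ≤ t}) := by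
    ext q
    by_cases hq : q.2 ∈ Set.Ioo (0 : ℝ) 1
    · simp only [Set.mem_preimage, Set.mem_Iic, quantile_le_iff _ hq, Set.mem_union,
        Set.mem_inter_iff, Set.mem_ofPred_eq, Set.mem_compl_iff, hq]
      tauto
    · simp only [Set.mem_preimage, Set.mem_Iic, quantile, Set.mem_union,
        Set.mem_inter_iff, Set.mem_ofPred_eq, Set.mem_compl_iff, hq]
      tauto
  rw [hset]
  have h1 : MeasurableSet {q : α × ℝ | q.2 ∈ Set.Ioo (0 : ℝ) 1} := measurable_snd measurableSet_Ioo
  have h2 : MeasurableSet {q : α × ℝ | q.2 ≤ (κ q.1).real (Set.Iic t)} :=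
    measurableSet_le measurable_snd
      ((κ.measurable_coe measurableSet_Iic).ennreal_toReal.comp measurable_fst)
  exact (h1.inter h2).union (h1.compl.inter (MeasurableSet.const _))

theorem measurable_quantile (μ : Measure ℝ) [IsProbabilityMeasure μ] :
    Measurable (quantile μ) :=
  (measurable_quantile_kernel (Kernel.const Unit μ)).comp (measurable_prodMk_left (x := ()))

theorem map_quantile (μ : Measure ℝ) [IsProbabilityMeasure μ] : unif.map (quantile μ) = μ := by
  have := Measure.isProbabilityMeasure_map (μ := unif) (measurable_quantile μ).aemeasurable
  refine Measure.ext_of_Iic _ _ fun t => ?_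
  rw [Measure.map_apply (measurable_quantile μ) measurableSet_Iic,
    Measure.restrict_apply (measurable_quantile μ measurableSet_Iic)]
  have hle : μ.real (Set.Iic t) ≤ 1 := measureReal_le_one
  refine le_antisymm ?_ ?_
  · calc _ ≤ volume (Set.Ioc 0 (μ.real (Set.Iic t))) := by
          refine measure_mono fun u ⟨h, hu⟩ => ⟨hu.1, (quantile_le_iff μ hu t).1 h⟩
      _ = _ := by simp
  -- The open interval is used because the cdf at `t` may equal 1, a level outside `(0, 1)`.
  · calc μ (Set.Iic t) = volume (Set.Ioo 0 (μ.real (Set.Iic t))) := by simp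
      _ ≤ _ := measure_mono fun u hu =>
          have hu' : u ∈ Set.Ioo (0 : ℝ) 1 := ⟨hu.1, hu.2.trans_le hle⟩
          Set.mem_inter ((quantile_le_iff μ hu' t).2 hu.2.le) hu'

/-! ### Optimality of the quantile coupling. -/

/-- The hinge functions `w ↦ (w - a)₊` generate `w ↦ w₊ ^ p`. -/
theorem exists_lintegral_hinge_eq_rpow {p : ℝ} (hp : 1 ≤ p) :
    ∃ m : Measure ℝ, SFinite m ∧
      ∀ w : ℝ, ∫⁻ a, ENNReal.ofReal (w - a) ∂m = ENNReal.ofReal w ^ p := by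
  rcases hp.eq_or_lt with rfl | hp
  -- The mixing measure is the second derivative of `w₊ ^ p`; for `p = 1` this is a point mass at 0.
  · exact ⟨Measure.dirac 0, inferInstance, fun w => by simp⟩
  have hmeas : Measurable fun a : ℝ => ENNReal.ofReal (p * (p - 1) * a ^ (p - 2)) := by fun_prop
  -- For `p > 1` the second derivative is a density, integrable near 0 because `p - 2 > -1`.
  refine ⟨(volume.restrict (Set.Ioi 0)).withDensity
    fun a => ENNReal.ofReal (p * (p - 1) * a ^ (p - 2)), inferInstance, fun w => ?_⟩
  rw [lintegral_withDensity_eq_lintegral_mul _ hmeas (by fun_prop)]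
  simp only [Pi.mul_apply]
  rcases le_or_gt w 0 with hw | hw
  · rw [ENNReal.ofReal_of_nonpos hw, ENNReal.zero_rpow_of_pos (by linarith)]
    refine (setLIntegral_congr_fun measurableSet_Ioi fun a ha => ?_).trans lintegral_zero
    have : (0 : ℝ) < a := ha
    simp only [ENNReal.ofReal_of_nonpos (show w - a ≤ 0 by linarith), mul_zero]
  have hsplit : Set.Ioi (0 : ℝ) = Set.Ioc 0 w ∪ Set.Ioi w := (Set.Ioc_union_Ioi_eq_Ioi hw.le).symm
  rw [hsplit, lintegral_union measurableSet_Ioi Set.Ioc_disjoint_Ioi_same]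
  have hzero : ∫⁻ a in Set.Ioi w, ENNReal.ofReal (p * (p - 1) * a ^ (p - 2)) *
      ENNReal.ofReal (w - a) = 0 := by
    refine (setLIntegral_congr_fun measurableSet_Ioi fun a ha => ?_).trans lintegral_zero
    have : w < a := ha
    simp only [ENNReal.ofReal_of_nonpos (show w - a ≤ 0 by linarith), mul_zero]
  rw [hzero, add_zero]
  have heq : ∫⁻ a in Set.Ioc 0 w, ENNReal.ofReal (p * (p - 1) * a ^ (p - 2)) *
      ENNReal.ofReal (w - a) =
      ∫⁻ a in Set.Ioc 0 w, ENNReal.ofReal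
        (p * (p - 1) * w * a ^ (p - 2) - p * (p - 1) * a ^ (p - 1)) := by
    refine setLIntegral_congr_fun measurableSet_Ioc fun a ha => ?_
    have ha0 : 0 < a := ha.1
    have hpow : a ^ (p - 1) = a ^ (p - 2) * a := by
      rw [← Real.rpow_add_one ha0.ne']; ring_nf
    rw [← ENNReal.ofReal_mul
      (mul_nonneg (mul_nonneg (by linarith) (by linarith)) (Real.rpow_nonneg ha0.le _)), hpow]
    ring_nf
  have hi1 : IntervalIntegrable (fun a : ℝ => p * (p - 1) * w * a ^ (p - 2)) volume 0 w :=
    (intervalIntegral.intervalIntegrable_rpow' (by linarith)).const_mul _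
  have hi2 : IntervalIntegrable (fun a : ℝ => p * (p - 1) * a ^ (p - 1)) volume 0 w :=
    (intervalIntegral.intervalIntegrable_rpow' (by linarith)).const_mul _
  rw [heq, ← ofReal_integral_eq_lintegral_ofReal
    ((intervalIntegrable_iff_integrableOn_Ioc_of_le hw.le).1 (hi1.sub hi2)),
    ← intervalIntegral.integral_of_le hw.le, intervalIntegral.integral_sub hi1 hi2,
    intervalIntegral.integral_const_mul, intervalIntegral.integral_const_mul,
    integral_rpow (Or.inl (by linarith)), integral_rpow (Or.inl (by linarith)),
    ENNReal.ofReal_rpow_of_pos hw]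
  · congr 1
    have e1 : p - 2 + 1 = p - 1 := by ring
    have e2 : p - 1 + 1 = p := by ring
    have hpow : w ^ p = w ^ (p - 1) * w := by
      rw [← Real.rpow_add_one hw.ne']; ring_nf
    have hp0 : p ≠ 0 := by linarith
    have hp1 : p - 1 ≠ 0 := by linarith
    rw [e1, e2, Real.zero_rpow hp1, Real.zero_rpow hp0, hpow]
    field_simp
    ring
  · refine (ae_restrict_iff' measurableSet_Ioc).2 (Eventually.of_forall fun a ha => ?_)
    have ha0 : 0 < a := ha.1
    have hpow : a ^ (p - 1) = a ^ (p - 2) * a := by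
      rw [← Real.rpow_add_one ha0.ne']; ring_nf
    have hnn : 0 ≤ p * (p - 1) * a ^ (p - 2) * (w - a) :=
      mul_nonneg (mul_nonneg (mul_nonneg (by linarith) (by linarith)) (Real.rpow_nonneg ha0.le _))
        (by linarith [ha.2])
    simp only [Pi.zero_apply, hpow]
    linarith

theorem ofReal_abs_sub_rpow {p : ℝ} (hp : 0 < p) (x y : ℝ) :
    ENNReal.ofReal |x - y| ^ p = ENNReal.ofReal (y - x) ^ p + ENNReal.ofReal (x - y) ^ p := by
  rcases le_total x y with h | h
  · rw [abs_of_nonpos (by linarith), ENNReal.ofReal_of_nonpos (p := x - y) (by linarith),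
      ENNReal.zero_rpow_of_pos hp, add_zero, neg_sub]
  · rw [abs_of_nonneg (by linarith), ENNReal.ofReal_of_nonpos (p := y - x) (by linarith),
      ENNReal.zero_rpow_of_pos hp, zero_add]

theorem measurableSet_quadrant {α : Type*} [MeasurableSpace α] {X Y : α → ℝ} (hX : Measurable X)
    (hY : Measurable Y) (t s : ℝ) : MeasurableSet {q | X q ≤ t ∧ s < Y q} :=
  (measurableSet_le hX measurable_const).inter (measurableSet_lt measurable_const hY)

/-- The hinge `(Y - X - a)₊` is the length of the set of `t` with `X ≤ t` and `t + a < Y`, so two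
applications of Tonelli turn the cost into an integral of quadrant masses. -/
theorem lintegral_posPart_rpow_eq {p : ℝ} {m : Measure ℝ} [SFinite m]
    (hm : ∀ w : ℝ, ∫⁻ a, ENNReal.ofReal (w - a) ∂m = ENNReal.ofReal w ^ p)
    {α : Type*} [MeasurableSpace α] (τ : Measure α) [SFinite τ] {X Y : α → ℝ}
    (hX : Measurable X) (hY : Measurable Y) :
    ∫⁻ q, ENNReal.ofReal (Y q - X q) ^ p ∂τ =
      ∫⁻ a, (∫⁻ t, τ {q | X q ≤ t ∧ t + a < Y q}) ∂m := by
  calc ∫⁻ q, ENNReal.ofReal (Y q - X q) ^ p ∂τ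
      = ∫⁻ q, ∫⁻ a, ENNReal.ofReal (Y q - X q - a) ∂m ∂τ := by simp_rw [hm]
    _ = ∫⁻ a, ∫⁻ q, ENNReal.ofReal (Y q - X q - a) ∂τ ∂m :=
        lintegral_lintegral_swap (by fun_prop)
    _ = ∫⁻ a, ∫⁻ q, volume {t | X q ≤ t ∧ t + a < Y q} ∂τ ∂m := by
        refine lintegral_congr fun a => lintegral_congr fun q => ?_
        have : {t | X q ≤ t ∧ t + a < Y q} = Set.Ico (X q) (Y q - a) := by
          ext t; simp [lt_sub_iff_add_lt]
        rw [this, Real.volume_Ico]; ring_nf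
    _ = ∫⁻ a, (∫⁻ t, τ {q | X q ≤ t ∧ t + a < Y q}) ∂m := by
        refine lintegral_congr fun a => ?_
        have hs : MeasurableSet {z : α × ℝ | X z.1 ≤ z.2 ∧ z.2 + a < Y z.1} :=
          (measurableSet_le (hX.comp measurable_fst) measurable_snd).inter
            (measurableSet_lt (measurable_snd.add_const a) (hY.comp measurable_fst))
        exact (Measure.prod_apply (μ := τ) (ν := volume) hs).symm.trans
          (Measure.prod_apply_symm hs)

/-- The one-sided cost `(y - x)₊ ^ p` depends monotonically on the masses of the quadrants
`{x ≤ t, s < y}`. -/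
theorem lintegral_posPart_rpow_le {p : ℝ} (hp : 1 ≤ p) {α β : Type*} [MeasurableSpace α]
    [MeasurableSpace β] (κ : Measure α) (ρ : Measure β) [SFinite κ] [SFinite ρ]
    {X Y : α → ℝ} {X' Y' : β → ℝ} (hX : Measurable X) (hY : Measurable Y)
    (hX' : Measurable X') (hY' : Measurable Y')
    (h : ∀ t s, κ {q | X q ≤ t ∧ s < Y q} ≤ ρ {q | X' q ≤ t ∧ s < Y' q}) :
    ∫⁻ q, ENNReal.ofReal (Y q - X q) ^ p ∂κ ≤ ∫⁻ q, ENNReal.ofReal (Y' q - X' q) ^ p ∂ρ := by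
  obtain ⟨m, hm, hmp⟩ := exists_lintegral_hinge_eq_rpow hp
  rw [lintegral_posPart_rpow_eq hmp κ hX hY, lintegral_posPart_rpow_eq hmp ρ hX' hY']
  exact lintegral_mono fun a => lintegral_mono fun t => h t (t + a)

/-- Under the quantile coupling the quadrant has mass at most `(μ(Iic t) - ν(Iic s))₊`. Every
coupling has at least this mass there, since `{x ≤ t}` is covered by the quadrant and `{y ≤ s}`. -/
theorem unif_quantile_quadrant_le {μ ν : Measure ℝ} [IsProbabilityMeasure μ]
    [IsProbabilityMeasure ν] {ρ : Measure (ℝ × ℝ)} (hμ : ρ.map Prod.fst = μ)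
    (hν : ρ.map Prod.snd = ν) (t s : ℝ) :
    unif {u | quantile μ u ≤ t ∧ s < quantile ν u} ≤ ρ {q | q.1 ≤ t ∧ s < q.2} := by
  have hms : MeasurableSet {u | quantile μ u ≤ t ∧ s < quantile ν u} :=
    measurableSet_quadrant (measurable_quantile μ) (measurable_quantile ν) t s
  rw [Measure.restrict_apply hms]
  calc _ ≤ volume (Set.Ioc (ν.real (Set.Iic s)) (μ.real (Set.Iic t))) := by
        refine measure_mono fun u ⟨⟨h1, h2⟩, hu⟩ => ⟨?_, (quantile_le_iff μ hu t).1 h1⟩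
        exact lt_of_not_ge fun h => h2.not_ge ((quantile_le_iff ν hu s).2 h)
    _ = μ (Set.Iic t) - ν (Set.Iic s) := by
        rw [Real.volume_Ioc, ENNReal.ofReal_sub _ measureReal_nonneg, ofReal_measureReal,
          ofReal_measureReal]
    _ ≤ ρ {q | q.1 ≤ t ∧ s < q.2} := by
        rw [tsub_le_iff_right, ← hμ, ← hν, Measure.map_apply measurable_fst measurableSet_Iic,
          Measure.map_apply measurable_snd measurableSet_Iic]
        refine (measure_mono fun q hq => ?_).trans (measure_union_le _ _)
        rcases lt_or_ge s q.2 with h | h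
        · exact Or.inl ⟨hq, h⟩
        · exact Or.inr h

theorem lintegral_quantile_le {p : ℝ} (hp : 1 ≤ p) {μ ν : Measure ℝ} [IsProbabilityMeasure μ]
    [IsProbabilityMeasure ν] {ρ : Measure (ℝ × ℝ)} (hρ : ρ ∈ couplings μ ν) :
    ∫⁻ u, ENNReal.ofReal |quantile μ u - quantile ν u| ^ p ∂unif ≤
      ∫⁻ q, ENNReal.ofReal |q.1 - q.2| ^ p ∂ρ := by
  obtain ⟨h1, h2⟩ := hρ
  have : IsProbabilityMeasure (ρ.map Prod.fst) := by rw [h1]; infer_instance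
  have : IsProbabilityMeasure ρ := Measure.isProbabilityMeasure_of_map Prod.fst
  have hp0 : 0 < p := by linarith
  have hq1 := measurable_quantile μ
  have hq2 := measurable_quantile ν
  simp_rw [ofReal_abs_sub_rpow hp0]
  rw [lintegral_add_left (by fun_prop), lintegral_add_left (by fun_prop)]
  refine add_le_add
    (lintegral_posPart_rpow_le hp _ _ hq1 hq2 measurable_fst measurable_snd
      (unif_quantile_quadrant_le h1 h2))
    (lintegral_posPart_rpow_le hp _ _ hq2 hq1 measurable_snd measurable_fst fun t s => ?_)
  -- The other one-sided cost is the same bound for the coupling with its coordinates exchanged.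
  have hswap : (ρ.map Prod.swap).map Prod.fst = ν ∧ (ρ.map Prod.swap).map Prod.snd = μ := by
    rw [Measure.map_map measurable_fst measurable_swap, Measure.map_map measurable_snd
      measurable_swap]
    exact ⟨h2, h1⟩
  have hle := unif_quantile_quadrant_le hswap.1 hswap.2 t s
  rwa [Measure.map_apply measurable_swap] at hle
  exact measurableSet_quadrant measurable_fst measurable_snd t s

theorem map_quantile_mem_couplings (μ ν : Measure ℝ) [IsProbabilityMeasure μ]
    [IsProbabilityMeasure ν] :
    unif.map (fun u => (quantile μ u, quantile ν u)) ∈ couplings μ ν := by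
  have hm := (measurable_quantile μ).prodMk (measurable_quantile ν)
  constructor
  · rw [Measure.map_map measurable_fst hm]; exact map_quantile μ
  · rw [Measure.map_map measurable_snd hm]; exact map_quantile ν

/-- The quantile coupling is optimal. -/
theorem wasserstein_eq_quantile {p : ℝ} (hp : 1 ≤ p) (μ ν : Measure ℝ) [IsProbabilityMeasure μ]
    [IsProbabilityMeasure ν] :
    wasserstein p μ ν =
      (∫⁻ u, ENNReal.ofReal |quantile μ u - quantile ν u| ^ p ∂unif) ^ (1 / p) := by
  have hp0 : 0 ≤ 1 / p := by positivity
  refine le_antisymm ?_ (le_iInf₂ fun ρ hρ =>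
    ENNReal.rpow_le_rpow (lintegral_quantile_le hp hρ) hp0)
  refine (iInf₂_le _ (map_quantile_mem_couplings μ ν)).trans_eq ?_
  rw [lintegral_map (by fun_prop) ((measurable_quantile μ).prodMk (measurable_quantile ν))]

/-! ### Separation and finiteness of the Wasserstein distance. -/

theorem lintegral_quantile_eq {p : ℝ} (hp : 1 ≤ p) (μ ν : Measure ℝ) [IsProbabilityMeasure μ]
    [IsProbabilityMeasure ν] :
    ∫⁻ u, ENNReal.ofReal |quantile μ u - quantile ν u| ^ p ∂unif = wasserstein p μ ν ^ p := by
  rw [wasserstein_eq_quantile hp, ← ENNReal.rpow_mul, one_div_mul_cancel (by linarith),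
    ENNReal.rpow_one]

/-- The optimal cost is attained by the quantile coupling, so cost zero makes the two quantile
functions agree almost everywhere, and each determines its law. -/
theorem eq_of_wasserstein_eq_zero {p : ℝ} (hp : 1 ≤ p) {μ ν : Measure ℝ}
    [IsProbabilityMeasure μ] [IsProbabilityMeasure ν] (h : wasserstein p μ ν = 0) : μ = ν := by
  have hp0 : 0 < p := by linarith
  have hq1 := measurable_quantile μ
  have hq2 := measurable_quantile ν
  have hint := lintegral_quantile_eq hp μ ν
  rw [h, ENNReal.zero_rpow_of_pos hp0, lintegral_eq_zero_iff (by fun_prop)] at hint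
  rw [← map_quantile μ, ← map_quantile ν]
  refine Measure.map_congr ?_
  filter_upwards [hint] with u hu
  rw [Pi.zero_apply, ENNReal.rpow_eq_zero_iff_of_pos hp0, ENNReal.ofReal_eq_zero] at hu
  exact sub_eq_zero.1 (abs_nonpos_iff.1 hu)

theorem ofReal_abs_add_rpow_le {p : ℝ} (hp : 1 ≤ p) (x y : ℝ) :
    ENNReal.ofReal |x + y| ^ p ≤
      2 ^ (p - 1) * (ENNReal.ofReal |x| ^ p + ENNReal.ofReal |y| ^ p) := by
  refine le_trans (ENNReal.rpow_le_rpow ?_ (by linarith))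
    (ENNReal.rpow_add_le_mul_rpow_add_rpow _ _ hp)
  rw [← ENNReal.ofReal_add (abs_nonneg _) (abs_nonneg _)]
  exact ENNReal.ofReal_le_ofReal (abs_add_le x y)

theorem wasserstein_rpow_le {p : ℝ} (hp : 1 ≤ p) (μ ν : Measure ℝ) [IsProbabilityMeasure μ]
    [IsProbabilityMeasure ν] :
    wasserstein p μ ν ^ p ≤ 2 ^ (p - 1) *
      (∫⁻ x, ENNReal.ofReal |x| ^ p ∂μ + ∫⁻ x, ENNReal.ofReal |x| ^ p ∂ν) := by
  -- Any coupling gives an upper bound; the independent one suffices.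
  have hc : μ.prod ν ∈ couplings μ ν := by constructor <;> simp [Measure.map_fst_prod,
    Measure.map_snd_prod]
  rw [← lintegral_quantile_eq hp]
  refine (lintegral_quantile_le hp hc).trans ?_
  calc _ ≤ ∫⁻ q : ℝ × ℝ, 2 ^ (p - 1) *
        (ENNReal.ofReal |q.1| ^ p + ENNReal.ofReal |q.2| ^ p) ∂(μ.prod ν) := by
        refine lintegral_mono fun q => ?_
        have := ofReal_abs_add_rpow_le hp q.1 (-q.2)
        rwa [abs_neg, ← sub_eq_add_neg] at this
    _ = _ := by
        rw [lintegral_const_mul _ (by fun_prop), lintegral_add_left (by fun_prop)]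
        have e1 : ∫⁻ q : ℝ × ℝ, ENNReal.ofReal |q.1| ^ p ∂(μ.prod ν) =
            ∫⁻ x, ENNReal.ofReal |x| ^ p ∂μ := by
          conv_rhs => rw [← hc.1]
          rw [lintegral_map (by fun_prop) measurable_fst]
        have e2 : ∫⁻ q : ℝ × ℝ, ENNReal.ofReal |q.2| ^ p ∂(μ.prod ν) =
            ∫⁻ x, ENNReal.ofReal |x| ^ p ∂ν := by
          conv_rhs => rw [← hc.2]
          rw [lintegral_map (by fun_prop) measurable_snd]
        rw [e1, e2]

/-! ### The Bellman operator: contraction and moment bounds. -/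

section Bellman

variable {S A : Type*} [MeasurableSpace S] [MeasurableSpace A]

/-- `bellmanKernel` as an operator on return distributions. -/
noncomputable def bellman (P : Kernel (S × A) S) [IsMarkovKernel P] {f : S × A → ℝ}
    (hf : Measurable f) (γ : ℝ) {g : S → A} (hg : Measurable g) (Z : ReturnDist S A) :
    ReturnDist S A :=
  ⟨bellmanKernel P f γ g Z.1,
    haveI := Z.2
    isMarkovKernel_bellmanKernel P hf γ hg Z.1⟩

instance (Z : ReturnDist S A) : IsMarkovKernel Z.1 := Z.2

variable (P : Kernel (S × A) S) [IsMarkovKernel P] {f : S × A → ℝ} (hf : Measurable f) (γ : ℝ)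
  {g : S → A} (hg : Measurable g)

theorem lintegral_bellman (Z : ReturnDist S A) (x : S × A) {h : ℝ → ℝ≥0∞} (hh : Measurable h) :
    ∫⁻ y, h y ∂((bellman P hf γ hg Z).1 x) =
      ∫⁻ s', ∫⁻ y, h (f x + γ * y) ∂(Z.1 (s', g s')) ∂(P x) := by
  have hZ : Measurable fun s' => Z.1 (s', g s') := Z.1.measurable.comp (by fun_prop)
  rw [bellman, bellmanKernel_apply P hf γ hg Z.1 x, lintegral_map hh (by fun_prop),
    Measure.lintegral_bind hZ.aemeasurable (by fun_prop)]

theorem bellman_apply (Z : ReturnDist S A) (x : S × A) {B : Set ℝ} (hB : MeasurableSet B) :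
    (bellman P hf γ hg Z).1 x B =
      ∫⁻ s', Z.1 (s', g s') ((fun y => f x + γ * y) ⁻¹' B) ∂(P x) := by
  have hZ : Measurable fun s' => Z.1 (s', g s') := Z.1.measurable.comp (by fun_prop)
  have hm : Measurable fun y : ℝ => f x + γ * y := by fun_prop
  rw [bellman, bellmanKernel_apply P hf γ hg Z.1 x, Measure.map_apply hm hB,
    Measure.bind_apply (hm hB) hZ.aemeasurable]

theorem measurable_quantile_policy (hg : Measurable g) (Z : ReturnDist S A) :
    Measurable fun q : S × ℝ => quantile (Z.1 (q.1, g q.1)) q.2 :=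
  (measurable_quantile_kernel Z.1).comp
    (((measurable_fst.prodMk (hg.comp measurable_fst))).prodMk measurable_snd)

/-- All randomness of a backup is carried by a pair `(s', u)` whose law does not depend on `Z`, so
two backups can be coupled by sharing it. -/
theorem map_prod_quantile (Z : ReturnDist S A) (x : S × A) :
    ((P x).prod unif).map (fun q => f x + γ * quantile (Z.1 (q.1, g q.1)) q.2) =
      (bellman P hf γ hg Z).1 x := by
  have hq := measurable_quantile_policy hg Z
  refine Measure.ext_of_lintegral _ fun h hh => ?_
  have hm : Measurable fun q : S × ℝ => f x + γ * quantile (Z.1 (q.1, g q.1)) q.2 := by fun_prop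
  rw [lintegral_bellman P hf γ hg Z x hh, lintegral_map hh hm,
    lintegral_prod (fun q : S × ℝ => h (f x + γ * quantile (Z.1 (q.1, g q.1)) q.2))
      (hh.comp hm).aemeasurable]
  refine lintegral_congr fun s' => ?_
  conv_rhs => rw [← map_quantile (Z.1 (s', g s'))]
  rw [lintegral_map (by fun_prop) (measurable_quantile _)]

theorem wasserstein_le_supWasserstein (p : ℝ) (Z₁ Z₂ : ReturnDist S A) (x : S × A) :
    wasserstein p (Z₁.1 x) (Z₂.1 x) ≤ supWasserstein p Z₁ Z₂ :=
  le_iSup₂ (f := fun s a => wasserstein p (Z₁.1 (s, a)) (Z₂.1 (s, a))) x.1 x.2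

variable {γ}

/-- With `(s', u)` shared, the signals cancel and the conditional cost given `s'` is `γ ^ p` times
the optimal cost at `(s', g s')`. No finiteness is needed, as `0 * ∞ = 0` in `ℝ≥0∞`. -/
theorem supWasserstein_bellman_le {p : ℝ} (hp : 1 ≤ p) (hγ : 0 ≤ γ) (Z₁ Z₂ : ReturnDist S A) :
    supWasserstein p (bellman P hf γ hg Z₁) (bellman P hf γ hg Z₂) ≤
      ENNReal.ofReal γ * supWasserstein p Z₁ Z₂ := by
  have hp0 : 0 < p := by linarith
  refine iSup₂_le fun s a => ?_
  have hq1 := measurable_quantile_policy hg Z₁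
  have hq2 := measurable_quantile_policy hg Z₂
  have hm : Measurable fun q : S × ℝ =>
      (f (s, a) + γ * quantile (Z₁.1 (q.1, g q.1)) q.2,
        f (s, a) + γ * quantile (Z₂.1 (q.1, g q.1)) q.2) := by fun_prop
  have hc : ((P (s, a)).prod unif).map (fun q : S × ℝ =>
      (f (s, a) + γ * quantile (Z₁.1 (q.1, g q.1)) q.2,
        f (s, a) + γ * quantile (Z₂.1 (q.1, g q.1)) q.2)) ∈
      couplings ((bellman P hf γ hg Z₁).1 (s, a)) ((bellman P hf γ hg Z₂).1 (s, a)) := by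
    constructor
    · rw [Measure.map_map measurable_fst hm]
      exact map_prod_quantile P hf γ hg Z₁ (s, a)
    · rw [Measure.map_map measurable_snd hm]
      exact map_prod_quantile P hf γ hg Z₂ (s, a)
  refine (iInf₂_le _ hc).trans ?_
  rw [one_div, ENNReal.rpow_inv_le_iff hp0, ENNReal.mul_rpow_of_nonneg _ _ hp0.le,
    lintegral_map (by fun_prop) hm, lintegral_prod _ (by fun_prop)]
  have hcost (s' : S) : ∫⁻ u, ENNReal.ofReal |f (s, a) + γ * quantile (Z₁.1 (s', g s')) u -
      (f (s, a) + γ * quantile (Z₂.1 (s', g s')) u)| ^ p ∂unif ≤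
      ENNReal.ofReal γ ^ p * supWasserstein p Z₁ Z₂ ^ p := by
    have hm1 := measurable_quantile (Z₁.1 (s', g s'))
    have hm2 := measurable_quantile (Z₂.1 (s', g s'))
    simp_rw [add_sub_add_left_eq_sub, ← mul_sub, abs_mul, abs_of_nonneg hγ,
      ENNReal.ofReal_mul hγ, ENNReal.mul_rpow_of_nonneg _ _ hp0.le]
    rw [lintegral_const_mul _ (by fun_prop), lintegral_quantile_eq hp]
    gcongr
    exact wasserstein_le_supWasserstein p Z₁ Z₂ (s', g s')
  calc _ ≤ ∫⁻ _, ENNReal.ofReal γ ^ p * supWasserstein p Z₁ Z₂ ^ p ∂(P (s, a)) :=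
        lintegral_mono hcost
    _ = _ := by simp

theorem supWasserstein_lt_top {p : ℝ} (hp : 1 ≤ p) {Z₁ Z₂ : ReturnDist S A}
    (h₁ : HasBoundedMoments p Z₁) (h₂ : HasBoundedMoments p Z₂) :
    supWasserstein p Z₁ Z₂ < ∞ := by
  obtain ⟨C₁, h₁⟩ := h₁
  obtain ⟨C₂, h₂⟩ := h₂
  have hp0 : 0 < p := by linarith
  have hfin : (2 ^ (p - 1) * (C₁ + C₂) : ℝ≥0∞) ≠ ∞ :=
    ENNReal.mul_ne_top (ENNReal.rpow_ne_top_of_nonneg (by linarith) (by simp)) (by simp)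
  have hle : supWasserstein p Z₁ Z₂ ≤ (2 ^ (p - 1) * (C₁ + C₂) : ℝ≥0∞) ^ p⁻¹ := by
    refine iSup₂_le fun s a => ?_
    rw [ENNReal.le_rpow_inv_iff hp0]
    refine (wasserstein_rpow_le hp _ _).trans ?_
    gcongr
    exacts [h₁ s a, h₂ s a]
  exact hle.trans_lt (ENNReal.rpow_lt_top_of_nonneg (by positivity) hfin)

theorem HasBoundedMoments.bellman {p : ℝ} (hp : 1 ≤ p) {B : ℝ} (hB : ∀ x, |f x| ≤ B)
    {Z : ReturnDist S A} (hZ : HasBoundedMoments p Z) :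
    HasBoundedMoments p (bellman P hf γ hg Z) := by
  obtain ⟨C, hC⟩ := hZ
  have hp0 : 0 ≤ p := by linarith
  set D : ℝ≥0∞ := 2 ^ (p - 1) * (ENNReal.ofReal B ^ p + ENNReal.ofReal |γ| ^ p * C) with hD
  have hfin : D ≠ ∞ := by
    refine ENNReal.mul_ne_top (ENNReal.rpow_ne_top_of_nonneg (by linarith) (by simp))
      (ENNReal.add_ne_top.2 ⟨?_, ENNReal.mul_ne_top ?_ (by simp)⟩) <;>
    exact ENNReal.rpow_ne_top_of_nonneg hp0 (by simp)
  refine ⟨D.toNNReal, fun s a => ?_⟩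
  rw [ENNReal.coe_toNNReal hfin, lintegral_bellman P hf γ hg Z _ (by fun_prop)]
  have hs (s' : S) :
      ∫⁻ y, ENNReal.ofReal |f (s, a) + γ * y| ^ p ∂(Z.1 (s', g s')) ≤ D := by
    calc _ ≤ ∫⁻ y, 2 ^ (p - 1) * (ENNReal.ofReal B ^ p +
          ENNReal.ofReal |γ| ^ p * ENNReal.ofReal |y| ^ p) ∂(Z.1 (s', g s')) := by
          refine lintegral_mono fun y => (ofReal_abs_add_rpow_le hp _ _).trans ?_
          rw [abs_mul, ENNReal.ofReal_mul (abs_nonneg _), ENNReal.mul_rpow_of_nonneg _ _ hp0]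
          gcongr
          exact hB _
      _ = 2 ^ (p - 1) * (ENNReal.ofReal B ^ p +
          ENNReal.ofReal |γ| ^ p * ∫⁻ y, ENNReal.ofReal |y| ^ p ∂(Z.1 (s', g s'))) := by
          rw [lintegral_const_mul _ (by fun_prop), lintegral_add_left (by fun_prop),
            lintegral_const_mul _ (by fun_prop)]
          simp
      _ ≤ D := by
          rw [hD]
          gcongr
          exact hC _ _
  calc _ ≤ ∫⁻ _, D ∂(P (s, a)) := lintegral_mono hs
    _ = D := by simp

/-! ### Existence of a fixed point by monotone iteration. -/

/-- The usual stochastic order, tested on upper sets. -/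
def StochLE (μ ν : Measure ℝ) : Prop :=
  ∀ B : Set ℝ, MeasurableSet B → IsUpperSet B → μ B ≤ ν B

theorem StochLE.quantile_le {μ ν : Measure ℝ} [IsProbabilityMeasure μ] [IsProbabilityMeasure ν]
    (h : StochLE μ ν) (u : ℝ) : quantile μ u ≤ quantile ν u := by
  by_cases hu : u ∈ Set.Ioo (0 : ℝ) 1
  · rw [quantile_le_iff μ hu]
    refine ((quantile_le_iff ν hu _).1 le_rfl).trans ?_
    have hle := ENNReal.toReal_mono (measure_ne_top _ _)
      (h (Set.Ioi (quantile ν u)) measurableSet_Ioi (isUpperSet_Ioi _))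
    rw [← Set.compl_Ioi, probReal_compl_eq_one_sub measurableSet_Ioi,
      probReal_compl_eq_one_sub measurableSet_Ioi]
    exact sub_le_sub_left hle 1
  · simp [quantile, hu]

/-- For `γ ≥ 0` the map `y ↦ f x + γ * y` is monotone, so it pulls upper sets back to upper sets.
Testing on all upper sets, not only rays, includes `γ = 0`, where the preimage is empty or the whole
line. -/
theorem stochLE_bellman (hγ : 0 ≤ γ) {Z₁ Z₂ : ReturnDist S A}
    (h : ∀ x, StochLE (Z₁.1 x) (Z₂.1 x)) (x : S × A) :
    StochLE ((bellman P hf γ hg Z₁).1 x) ((bellman P hf γ hg Z₂).1 x) := by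
  intro B hB hup
  rw [bellman_apply P hf γ hg _ _ hB, bellman_apply P hf γ hg _ _ hB]
  refine lintegral_mono fun s' => h _ _ ((by fun_prop : Measurable fun y => f x + γ * y) hB) ?_
  exact fun y y' hy hmem => hup (add_le_add_right (mul_le_mul_of_nonneg_left hy hγ) _) hmem

theorem bellman_ae_mem_Icc {b : ℝ} (hγ : 0 ≤ γ) (hγ' : γ < 1) (hfb : ∀ x, f x ∈ Set.Icc 0 b)
    {Z : ReturnDist S A} (hZ : ∀ x, ∀ᵐ y ∂(Z.1 x), y ∈ Set.Icc 0 (b / (1 - γ))) (x : S × A) :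
    ∀ᵐ y ∂((bellman P hf γ hg Z).1 x), y ∈ Set.Icc 0 (b / (1 - γ)) := by
  have h1 : 0 < 1 - γ := by linarith
  -- The right endpoint is the fixed point of `t ↦ b + γ * t`, which makes the interval invariant.
  have hb : b + γ * (b / (1 - γ)) = b / (1 - γ) := by field_simp; ring
  rw [ae_iff]
  change (bellman P hf γ hg Z).1 x (Set.Icc 0 (b / (1 - γ)))ᶜ = 0
  rw [bellman_apply P hf γ hg _ _ measurableSet_Icc.compl]
  refine (lintegral_congr fun s' => ?_).trans lintegral_zero
  have hnull : Z.1 (s', g s') (Set.Icc 0 (b / (1 - γ)))ᶜ = 0 := ae_iff.1 (hZ (s', g s'))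
  refine measure_mono_null (fun y hy => ?_) hnull
  refine fun hmem => hy ?_
  have hfx := hfb x
  refine ⟨add_nonneg hfx.1 (mul_nonneg hγ hmem.1), ?_⟩
  rw [← hb]
  exact add_le_add hfx.2 (mul_le_mul_of_nonneg_left hmem.2 hγ)

theorem hasBoundedMoments_of_ae_mem_Icc {p : ℝ} (hp : 0 ≤ p) {C : ℝ} {Z : ReturnDist S A}
    (hZ : ∀ x, ∀ᵐ y ∂(Z.1 x), y ∈ Set.Icc 0 C) : HasBoundedMoments p Z := by
  have hfin : ENNReal.ofReal C ^ p ≠ ∞ := ENNReal.rpow_ne_top_of_nonneg hp (by simp)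
  refine ⟨(ENNReal.ofReal C ^ p).toNNReal, fun s a => ?_⟩
  rw [ENNReal.coe_toNNReal hfin]
  calc _ ≤ ∫⁻ _, ENNReal.ofReal C ^ p ∂(Z.1 (s, a)) := by
        refine lintegral_mono_ae ?_
        filter_upwards [hZ (s, a)] with y hy
        rw [abs_of_nonneg hy.1]
        gcongr
        exact hy.2
    _ = _ := by simp

theorem lintegral_nnreal_le (μ : Measure ℝ) [IsProbabilityMeasure μ]
    (h : BoundedContinuousFunction ℝ ℝ≥0) : ∫⁻ y, (h y : ℝ≥0∞) ∂μ ≤ nndist h 0 := by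
  calc _ ≤ ∫⁻ _, (nndist h 0 : ℝ≥0∞) ∂μ :=
        lintegral_mono fun y => 
          ENNReal.coe_le_coe.2 (BoundedContinuousFunction.NNReal.upper_bound h y)
    _ = _ := by simp

/-- A stochastically increasing, uniformly bounded sequence of return distributions converges
weakly, pointwise in the state and the action. -/
theorem exists_tendsto_of_stochLE {C : ℝ} {Z : ℕ → ReturnDist S A}
    (hmono : ∀ k x, StochLE ((Z k).1 x) ((Z (k + 1)).1 x))
    (hsupp : ∀ k x, ∀ᵐ y ∂((Z k).1 x), y ∈ Set.Icc 0 C) :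
    ∃ Z' : ReturnDist S A, (∀ x, ∀ᵐ y ∂(Z'.1 x), y ∈ Set.Icc 0 C) ∧
      ∀ x (h : BoundedContinuousFunction ℝ ℝ≥0),
        Tendsto (fun k => ∫⁻ y, (h y : ℝ≥0∞) ∂((Z k).1 x)) atTop
          (𝓝 (∫⁻ y, (h y : ℝ≥0∞) ∂(Z'.1 x))) := by
  -- The limit law is that of the supremum of the quantiles at a common level. The default value of
  -- an unbounded real supremum is harmless: for each `x` the quantiles lie in `[0, C]` for almost
  -- every `u`.
  set Q : (S × A) × ℝ → ℝ := fun q => ⨆ k, quantile ((Z k).1 q.1) q.2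
  have hQ : Measurable Q := Measurable.iSup fun k => measurable_quantile_kernel (Z k).1
  have hQx (x : S × A) : Measurable fun u => Q (x, u) := hQ.comp measurable_prodMk_left
  have hmem (x : S × A) : ∀ᵐ u ∂unif, ∀ k, quantile ((Z k).1 x) u ∈ Set.Icc 0 C := by
    rw [ae_all_iff]
    intro k
    have := hsupp k x
    rw [← map_quantile ((Z k).1 x)] at this
    exact ae_of_ae_map (measurable_quantile _).aemeasurable this
  have hlim (x : S × A) :
      ∀ᵐ u ∂unif, Tendsto (fun k => quantile ((Z k).1 x) u) atTop (𝓝 (Q (x, u))) := by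
    filter_upwards [hmem x] with u hu
    exact tendsto_atTop_ciSup (monotone_nat_of_le_succ fun k => (hmono k x).quantile_le u)
      ⟨C, by rintro _ ⟨k, rfl⟩; exact (hu k).2⟩
  set κ : Kernel (S × A) ℝ := (Kernel.id ×ₖ Kernel.const (S × A) unif).map Q with hκ
  have hκx (x : S × A) : κ x = unif.map fun u => Q (x, u) := by
    rw [hκ, Kernel.map_apply _ hQ, Kernel.prod_apply, Kernel.id_apply, Kernel.const_apply,
      Measure.dirac_prod, Measure.map_map hQ measurable_prodMk_left]
    rfl
  refine ⟨⟨κ, Kernel.IsMarkovKernel.map _ hQ⟩, fun x => ?_, fun x h => ?_⟩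
  · change ∀ᵐ y ∂(κ x), y ∈ Set.Icc 0 C
    rw [hκx]
    refine (ae_map_iff (p := (· ∈ Set.Icc 0 C)) (hQx x).aemeasurable measurableSet_Icc).2 ?_
    filter_upwards [hlim x, hmem x] with u hu hk
    exact isClosed_Icc.mem_of_tendsto hu (Eventually.of_forall hk)
  · change Tendsto _ _ (𝓝 (∫⁻ y, (h y : ℝ≥0∞) ∂(κ x)))
    have hh : Measurable fun y => (h y : ℝ≥0∞) := by fun_prop
    rw [hκx, lintegral_map hh (hQx x)]
    have hk (k : ℕ) : ∫⁻ y, (h y : ℝ≥0∞) ∂((Z k).1 x) =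
        ∫⁻ u, (h (quantile ((Z k).1 x) u) : ℝ≥0∞) ∂unif := by
      conv_lhs => rw [← map_quantile ((Z k).1 x)]
      rw [lintegral_map hh (measurable_quantile _)]
    simp_rw [hk]
    refine tendsto_lintegral_of_dominated_convergence (fun _ => (nndist h 0 : ℝ≥0∞))
      (fun k => hh.comp (measurable_quantile _)) (fun k => Eventually.of_forall fun u => ?_)
      (by simp) ?_
    · exact ENNReal.coe_le_coe.2 (BoundedContinuousFunction.NNReal.upper_bound h _)
    · filter_upwards [hlim x] with u hu
      exact ENNReal.tendsto_coe.2 ((h.continuous.tendsto _).comp hu)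

/-- The Bellman operator is continuous for weak convergence, so weak limits of its iterates are
fixed points. -/
theorem bellman_eq_of_tendsto {Z : ℕ → ReturnDist S A} {Z' : ReturnDist S A}
    (hsucc : ∀ k, Z (k + 1) = bellman P hf γ hg (Z k))
    (hlim : ∀ x (h : BoundedContinuousFunction ℝ ℝ≥0),
      Tendsto (fun k => ∫⁻ y, (h y : ℝ≥0∞) ∂((Z k).1 x)) atTop
        (𝓝 (∫⁻ y, (h y : ℝ≥0∞) ∂(Z'.1 x)))) :
    bellman P hf γ hg Z' = Z' := by
  refine Subtype.ext (Kernel.ext fun x => ?_)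
  refine ext_of_forall_lintegral_eq_of_IsFiniteMeasure fun h => ?_
  refine tendsto_nhds_unique ?_ ((tendsto_add_atTop_iff_nat 1).2 (hlim x h))
  simp_rw [hsucc]
  have hh : Measurable fun y => (h y : ℝ≥0∞) := by fun_prop
  simp_rw [lintegral_bellman P hf γ hg _ x hh]
  -- Composing the test function with the affine map gives another bounded continuous test function.
  -- Weak convergence then applies for each `s'`, and dominated convergence handles the integral
  -- over `s'`.
  set h' : BoundedContinuousFunction ℝ ℝ≥0 :=
    h.compContinuous ⟨fun y => f x + γ * y, by fun_prop⟩
  have hh' : Measurable fun y => (h' y : ℝ≥0∞) := by fun_prop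
  refine tendsto_lintegral_of_dominated_convergence (fun _ => (nndist h' 0 : ℝ≥0∞))
    (fun k => ?_) (fun k => Eventually.of_forall fun s' => lintegral_nnreal_le _ h') (by simp)
    (Eventually.of_forall fun s' => hlim (s', g s') h')
  exact (hh'.lintegral_kernel (κ := (Z k).1)).comp (measurable_id.prodMk hg)

theorem exists_bellman_eq {b : ℝ} (hγ : 0 ≤ γ) (hγ' : γ < 1) (hfb : ∀ x, f x ∈ Set.Icc 0 b) :
    ∃ Z : ReturnDist S A, (∀ x, ∀ᵐ y ∂(Z.1 x), y ∈ Set.Icc 0 (b / (1 - γ))) ∧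
      bellman P hf γ hg Z = Z := by
  set Z₀ : ReturnDist S A := ⟨Kernel.const _ (Measure.dirac 0), inferInstance⟩
  have hsucc (k : ℕ) : (bellman P hf γ hg)^[k + 1] Z₀ =
      bellman P hf γ hg ((bellman P hf γ hg)^[k] Z₀) := Function.iterate_succ_apply' _ _ _
  have hsupp (k : ℕ) : ∀ x, ∀ᵐ y ∂(((bellman P hf γ hg)^[k] Z₀).1 x),
      y ∈ Set.Icc 0 (b / (1 - γ)) := by
    induction k with
    | zero =>
      intro x
      have hb : 0 ≤ b := (hfb x).1.trans (hfb x).2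
      change ∀ᵐ y ∂(Measure.dirac (0 : ℝ)), _
      exact (ae_dirac_iff (p := (· ∈ Set.Icc 0 (b / (1 - γ)))) measurableSet_Icc).2 ⟨le_rfl, div_nonneg hb (by linarith)⟩
    | succ k ih =>
      rw [hsucc]
      exact bellman_ae_mem_Icc P hf hg hγ hγ' hfb ih
  have hmono (k : ℕ) : ∀ x, StochLE (((bellman P hf γ hg)^[k] Z₀).1 x)
      (((bellman P hf γ hg)^[k + 1] Z₀).1 x) := by
    induction k with
    | zero =>
      intro x B hB hup
      change Measure.dirac (0 : ℝ) B ≤ _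
      -- An upper set containing 0 contains the support `[0, b / (1 - γ)]` of the first iterate,
      -- hence has full mass; otherwise the point mass at 0 gives it none.
      by_cases h0 : (0 : ℝ) ∈ B
      · have hone : ∀ᵐ y ∂(((bellman P hf γ hg)^[1] Z₀).1 x), y ∈ B := by
          filter_upwards [hsupp 1 x] with y hy
          exact hup hy.1 h0
        rw [(prob_compl_eq_zero_iff hB).1 (ae_iff.1 hone)]
        exact prob_le_one
      · simp [Measure.dirac_apply' _ hB, h0]
    | succ k ih =>
      intro x
      have := stochLE_bellman P hf hg hγ ih x
      rwa [← hsucc, ← hsucc] at this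
  obtain ⟨Z, hZ, hlim⟩ := exists_tendsto_of_stochLE hmono hsupp
  exact ⟨Z, hZ, bellman_eq_of_tendsto P hf hg hsucc hlim⟩

/-! ### Geometric convergence and uniqueness. -/

theorem supWasserstein_iterate_bellman_le {p : ℝ} (hp : 1 ≤ p) (hγ : 0 ≤ γ)
    {Z : ReturnDist S A} (hZ : bellman P hf γ hg Z = Z) (Z₀ : ReturnDist S A) (k : ℕ) :
    supWasserstein p ((bellman P hf γ hg)^[k] Z₀) Z ≤
      ENNReal.ofReal γ ^ k * supWasserstein p Z₀ Z := by
  induction k with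
  | zero => simp
  | succ k ih =>
    rw [Function.iterate_succ_apply', pow_succ', mul_assoc]
    conv_lhs => rw [← hZ]
    exact (supWasserstein_bellman_le P hf hg hp hγ _ _).trans (mul_le_mul_right ih _)

/-- The contraction gives `d ≤ γ d` for the distance `d` of two fixed points. Finiteness is
essential here: `d = ∞` satisfies this when `γ > 0`. -/
theorem eq_of_bellman_eq {p : ℝ} (hp : 1 ≤ p) (hγ : 0 ≤ γ) (hγ' : γ < 1) {Z₁ Z₂ : ReturnDist S A}
    (hfin : supWasserstein p Z₁ Z₂ < ∞) (h₁ : bellman P hf γ hg Z₁ = Z₁)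
    (h₂ : bellman P hf γ hg Z₂ = Z₂) : Z₁ = Z₂ := by
  have hle := supWasserstein_bellman_le P hf hg hp hγ Z₁ Z₂
  rw [h₁, h₂] at hle
  have hzero : supWasserstein p Z₁ Z₂ = 0 := by
    by_contra hne
    refine hle.not_gt ?_
    calc _ < 1 * supWasserstein p Z₁ Z₂ :=
          ENNReal.mul_lt_mul_left hne hfin.ne (by simpa using hγ')
      _ = _ := one_mul _
  refine Subtype.ext (Kernel.ext fun x => eq_of_wasserstein_eq_zero hp ?_)
  exact le_antisymm ((wasserstein_le_supWasserstein p Z₁ Z₂ x).trans_eq hzero) zero_le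

theorem exists_unique_bellman_eq_and_tendsto {p b : ℝ} (hp : 1 ≤ p) (hγ : 0 ≤ γ) (hγ' : γ < 1)
    (hfb : ∀ x, f x ∈ Set.Icc 0 b) :
    ∃ Z' : ReturnDist S A, HasBoundedMoments p Z' ∧ bellman P hf γ hg Z' = Z' ∧
      (∀ Z : ReturnDist S A, HasBoundedMoments p Z → bellman P hf γ hg Z = Z → Z = Z') ∧
      (∀ (Z₀ : ReturnDist S A) (k : ℕ), supWasserstein p ((bellman P hf γ hg)^[k] Z₀) Z' ≤
        ENNReal.ofReal γ ^ k * supWasserstein p Z₀ Z') ∧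
      (∀ Z₀ : ReturnDist S A, HasBoundedMoments p Z₀ →
        Tendsto (fun k : ℕ => supWasserstein p ((bellman P hf γ hg)^[k] Z₀) Z') atTop (𝓝 0)) := by
  obtain ⟨Z', hsupp, hfix⟩ := exists_bellman_eq P hf hg hγ hγ' hfb
  have hZ' : HasBoundedMoments p Z' := hasBoundedMoments_of_ae_mem_Icc (by linarith) hsupp
  have hiter := supWasserstein_iterate_bellman_le P hf hg hp hγ hfix
  refine ⟨Z', hZ', hfix, fun Z hZ hZfix => eq_of_bellman_eq P hf hg hp hγ hγ'
    (supWasserstein_lt_top hp hZ hZ') hZfix hfix, hiter, fun Z₀ hZ₀ => ?_⟩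
  have hpow := ENNReal.Tendsto.mul_const
    (ENNReal.tendsto_pow_atTop_nhds_zero_of_lt_one (r := ENNReal.ofReal γ) (by simpa using hγ'))
    (Or.inr (supWasserstein_lt_top hp hZ₀ hZ').ne)
  rw [zero_mul] at hpow
  exact tendsto_of_tendsto_of_tendsto_of_le_of_le tendsto_const_nhds hpow
    (fun _ => zero_le) (hiter Z₀)

end Bellman

end LatentRL

theorem mainTheorem1 {S A L : Type*} [MeasurableSpace S] [MeasurableSpace A]
    (M : LatentRL.LatentCMDP S A L) (π : LatentRL.Policy S A L) (z : L) (p : ℝ) (hp : 1 ≤ p) :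
    -- the supremal distance is finite on return distributions with bounded moments
    (∀ Z₁ Z₂ : LatentRL.ReturnDist S A,
      LatentRL.HasBoundedMoments p Z₁ → LatentRL.HasBoundedMoments p Z₂ →
        LatentRL.supWasserstein p Z₁ Z₂ < ∞) ∧
    -- both operators preserve bounded moments
    (∀ Z : LatentRL.ReturnDist S A, LatentRL.HasBoundedMoments p Z →
      LatentRL.HasBoundedMoments p (LatentRL.rewardBellman M π z Z) ∧
      LatentRL.HasBoundedMoments p (LatentRL.costBellman M π z Z)) ∧
    -- both operators are contractions with factor `γ`
    (∀ Z₁ Z₂ : LatentRL.ReturnDist S A,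
      LatentRL.supWasserstein p (LatentRL.rewardBellman M π z Z₁) (LatentRL.rewardBellman M π z Z₂)
        ≤ ENNReal.ofReal M.γ * LatentRL.supWasserstein p Z₁ Z₂ ∧
      LatentRL.supWasserstein p (LatentRL.costBellman M π z Z₁) (LatentRL.costBellman M π z Z₂)
        ≤ ENNReal.ofReal M.γ * LatentRL.supWasserstein p Z₁ Z₂) ∧
    -- the reward operator: unique fixed point and geometric convergence
    (∃ Zr : LatentRL.ReturnDist S A,
      LatentRL.HasBoundedMoments p Zr ∧ LatentRL.rewardBellman M π z Zr = Zr ∧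
      (∀ Z : LatentRL.ReturnDist S A, LatentRL.HasBoundedMoments p Z →
        LatentRL.rewardBellman M π z Z = Z → Z = Zr) ∧
      (∀ (Z₀ : LatentRL.ReturnDist S A) (k : ℕ),
        LatentRL.supWasserstein p ((LatentRL.rewardBellman M π z)^[k] Z₀) Zr
          ≤ ENNReal.ofReal M.γ ^ k * LatentRL.supWasserstein p Z₀ Zr) ∧
      (∀ Z₀ : LatentRL.ReturnDist S A, LatentRL.HasBoundedMoments p Z₀ →
        Tendsto (fun k : ℕ => LatentRL.supWasserstein p ((LatentRL.rewardBellman M π z)^[k] Z₀) Zr)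
          atTop (𝓝 0))) ∧
    -- the cost operator: unique fixed point and geometric convergence
    (∃ Zc : LatentRL.ReturnDist S A,
      LatentRL.HasBoundedMoments p Zc ∧ LatentRL.costBellman M π z Zc = Zc ∧
      (∀ Z : LatentRL.ReturnDist S A, LatentRL.HasBoundedMoments p Z →
        LatentRL.costBellman M π z Z = Z → Z = Zc) ∧
      (∀ (Z₀ : LatentRL.ReturnDist S A) (k : ℕ),
        LatentRL.supWasserstein p ((LatentRL.costBellman M π z)^[k] Z₀) Zc
          ≤ ENNReal.ofReal M.γ ^ k * LatentRL.supWasserstein p Z₀ Zc) ∧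
      (∀ Z₀ : LatentRL.ReturnDist S A, LatentRL.HasBoundedMoments p Z₀ →
        Tendsto (fun k : ℕ => LatentRL.supWasserstein p ((LatentRL.costBellman M π z)^[k] Z₀) Zc)
          atTop (𝓝 0))) := by
  have hM := M.trans_markov z
  have hr (x : S × A) : M.reward x.1 x.2 z ∈ Set.Icc 0 (M.rewardMax z) := M.reward_mem _ _ _
  have hc (x : S × A) : M.cost x.1 x.2 z ∈ Set.Icc 0 (M.costMax z) := M.cost_mem _ _ _
  have habs {y b : ℝ} (hy : y ∈ Set.Icc 0 b) : |y| ≤ b := (abs_of_nonneg hy.1).trans_le hy.2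
  have hmr := M.reward_measurable z
  have hmc := M.cost_measurable z
  have hπ := π.measurable_act z
  -- `rewardBellman` and `costBellman` are by definition `bellman` for the signals `r` and `c`, so
  -- both halves are instances of the same results.
  exact ⟨fun Z₁ Z₂ => LatentRL.supWasserstein_lt_top hp,
    fun Z hZ => ⟨LatentRL.HasBoundedMoments.bellman _ hmr hπ hp (fun x => habs (hr x)) hZ,
      LatentRL.HasBoundedMoments.bellman _ hmc hπ hp (fun x => habs (hc x)) hZ⟩,
    fun Z₁ Z₂ => ⟨LatentRL.supWasserstein_bellman_le _ hmr hπ hp M.γ_nonneg Z₁ Z₂,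
      LatentRL.supWasserstein_bellman_le _ hmc hπ hp M.γ_nonneg Z₁ Z₂⟩,
    LatentRL.exists_unique_bellman_eq_and_tendsto _ hmr hπ hp M.γ_nonneg M.γ_lt_one hr,
    LatentRL.exists_unique_bellman_eq_and_tendsto _ hmc hπ hp M.γ_nonneg M.γ_lt_one hc⟩
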